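/- Let $G$ be a finite group and let $R$ be a (commutative) integral domain with $1$, of characteristic $p\ge 0$, such that $p$ does not divide $|G|$ (this holds automatically when $p=0$). Let $RG$ be the group ring and $\mathcal{Z}(RG)$ its centre. For $R$-algebra endomorphisms $\sigma,\tau$ of $RG$, a $(\sigma,\tau)$-derivation of $RG$ is an $R$-linear map $\delta:RG\to RG$ with $\delta(ab)=\delta(a)\tau(b)+\sigma(a)\delta(b)$ for all $a,b\in RG$; it is called $(\sigma,\tau)$-inner if there is $x\in RG$ such that $\delta(a)=x\tau(a)-\sigma(a)x$ for all $a\in RG$. (i) If $R$ is a field and $\sigma,\tau$ are $R$-algebra endomorphisms of $RG$ that fix $\mathcal{Z}(RG)$ elementwise, then every $(\sigma,\tau)$-derivation of $RG$ is $(\sigma,\tau)$-inner. (ii) If $R$ is not a field and $\sigma,\tau$ are $R$-linear extensions to $RG$ of group homomorphisms $G\to G$, and $\sigma,\tau$ fix $\mathcal{Z}(RG)$ elementwise, then every $(\sigma,\tau)$-derivation of $RG$ is $(\sigma,\tau)$-inner. -/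

import Mathlib

/-- An `R`-linear map `δ : A → A` is a `(σ, τ)`-derivation if
`δ (a b) = δ a · τ b + σ a · δ b` for all `a, b`. -/
def IsSigmaTauDerivation {R A : Type*} [CommRing R] [Ring A] [Algebra R A]
    (σ τ : A →ₐ[R] A) (δ : A →ₗ[R] A) : Prop :=
  ∀ a b : A, δ (a * b) = δ a * τ b + σ a * δ b

/-- `δ` is `(σ, τ)`-inner if there is `x` in `A` with `δ a = x · τ a - σ a · x` for all `a`. -/
def IsSigmaTauInner {R A : Type*} [CommRing R] [Ring A] [Algebra R A]
    (σ τ : A →ₐ[R] A) (δ : A →ₗ[R] A) : Prop :=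
  ∃ x : A, ∀ a : A, δ a = x * τ a - σ a * x

/-- `σ` fixes the centre of `A` elementwise. -/
def FixesCenter {R A : Type*} [CommRing R] [Ring A] [Algebra R A] (σ : A →ₐ[R] A) : Prop :=
  ∀ z ∈ Subalgebra.center R A, σ z = z

/-- `σ` is the `R`-linear extension to the group ring of a group homomorphism `G → G`. -/
def IsLinearExtension {R G : Type*} [CommRing R] [Group G]
    (σ : MonoidAlgebra R G →ₐ[R] MonoidAlgebra R G) : Prop :=
  ∃ f : G →* G, ∀ g : G, σ (MonoidAlgebra.of R G g) = MonoidAlgebra.of R G (f g)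

/-! Over a field `|G|` is invertible, and a Maschke-type average gives the inner element. Over a
domain no division is available. There, for `σ`, `τ` induced by `f`, `k`, the coefficients of `δ g`
form a cocycle with values in functions on `G`, under the action `x ↦ f g * x * (k g)⁻¹`. On a
stabiliser it is a homomorphism to `R`, killed by `|G|`, hence zero, so it integrates along orbits.
-/

/-- On a group algebra whose group order is invertible in the coefficients, every
`(σ, τ)`-derivation is `(σ, τ)`-inner, by averaging. -/
theorem IsSigmaTauDerivation.isSigmaTauInner_of_isUnit_card {G R : Type*} [Group G] [Finite G]
    [CommRing R] (hG : IsUnit (Nat.card G : R)) {σ τ : MonoidAlgebra R G →ₐ[R] MonoidAlgebra R G}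
    {δ : MonoidAlgebra R G →ₗ[R] MonoidAlgebra R G} (hδ : IsSigmaTauDerivation σ τ δ) :
    IsSigmaTauInner σ τ δ := by
  have := Fintype.ofFinite G
  obtain ⟨u, hu⟩ := hG
  let of := MonoidAlgebra.of R G
  set S : MonoidAlgebra R G := ∑ g : G, σ (of g⁻¹) * δ (of g) with hS
  -- Reindexing `g ↦ g * h` costs one `δ h` per summand, `|G|` in all.
  have key (h : G) : S * τ (of h) = σ (of h) * S - (u : R) • δ (of h) := by
    have h1 (g : G) : σ (of g⁻¹) * δ (of g) * τ (of h) =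
        σ (of h) * (σ (of (g * h)⁻¹) * δ (of (g * h))) - δ (of h) := by
      have e1 : σ (of h) * σ (of (g * h)⁻¹) = σ (of g⁻¹) := by
        rw [← map_mul, ← map_mul]; simp
      have e2 : σ (of g⁻¹) * σ (of g) = 1 := by
        rw [← map_mul, ← map_mul]; simp
      rw [← mul_assoc, e1, map_mul of g h, hδ, mul_add, ← mul_assoc, ← mul_assoc, e2, one_mul,
        add_sub_cancel_right]
    have h2 : ∑ g : G, σ (of (g * h)⁻¹) * δ (of (g * h)) = S :=
      Equiv.sum_comp (Equiv.mulRight h) fun g => σ (of g⁻¹) * δ (of g)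
    rw [hS, Finset.sum_mul, Finset.sum_congr rfl fun g _ => h1 g, Finset.sum_sub_distrib,
      ← Finset.mul_sum, h2, ← hS]
    simp [hu, Nat.cast_smul_eq_nsmul]
  refine ⟨-((↑u⁻¹ : R) • S), fun a => ?_⟩
  induction a using MonoidAlgebra.induction_on with
  | of h =>
    change δ (of h) = _ * τ (of h) - σ (of h) * _
    rw [neg_mul, mul_neg, smul_mul_assoc, mul_smul_comm, key, smul_sub, smul_smul]
    simp
  | add a b ha hb => rw [map_add, map_add, map_add, ha, hb, mul_add, add_mul]; abel
  | smul r a ha => simp only [map_smul, ha, mul_smul_comm, smul_mul_assoc, smul_sub]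

/-- A `1`-cocycle of a finite group with values in the functions on a `G`-set is a coboundary if
the values form a domain in which the order of `G` is nonzero. -/
theorem exists_coboundary_of_cocycle {G X R : Type*} [Group G] [Finite G] [MulAction G X]
    [CommRing R] [IsDomain R] (hG : (Nat.card G : R) ≠ 0) (c : G → X → R)
    (hc : ∀ g h x, c (g * h) x = c g x + c h (g⁻¹ • x)) :
    ∃ m : X → R, ∀ g x, c g x = m x - m (g⁻¹ • x) := by
  have hstab (s : G) (x : X) (hs : s • x = x) : c s x = 0 := by
    have hs' : s⁻¹ • x = x := inv_smul_eq_iff.mpr hs.symm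
    have h1 : c 1 x = 0 := by simpa using hc 1 1 x
    have hpow (n : ℕ) : c (s ^ n) x = n * c s x := by
      induction n with
      | zero => simpa using h1
      | succ n ih => rw [pow_succ', hc, hs', ih]; push_cast; ring
    have := hpow (Nat.card G)
    rw [pow_card_eq_one', h1] at this
    exact (mul_eq_zero.mp this.symm).resolve_left hG
  let _ := MulAction.orbitRel G X
  let rep (x : X) : X := (Quotient.mk (MulAction.orbitRel G X) x).out
  have hrep (x : X) : ∃ g : G, g • rep x = x :=
    MulAction.orbitRel_apply.mp (Setoid.symm (Quotient.mk_out (s := MulAction.orbitRel G X) x))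
  have rep_smul (g : G) (x : X) : rep (g • x) = rep x :=
    congrArg Quotient.out (Quotient.sound (s := MulAction.orbitRel G X) ⟨g, rfl⟩)
  choose t ht using hrep
  -- Two elements carrying `rep x` to `x` differ by a stabiliser element, where `c` vanishes: the
  -- potential `c (t x) x` is independent of `t`.
  have hm (h : G) (x : X) (hx : h • rep x = x) : c (t x) x = c h x := by
    have e : h⁻¹ • x = rep x := inv_smul_eq_iff.mpr hx.symm
    have := hc h (h⁻¹ * t x) x
    rwa [mul_inv_cancel_left, e, hstab (h⁻¹ * t x) (rep x) (by rw [mul_smul, ht, e]),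
      add_zero] at this
  refine ⟨fun x => c (t x) x, fun g x => ?_⟩
  have := hc g (g⁻¹ * t x) x
  rw [mul_inv_cancel_left] at this
  change c g x = c (t x) x - c (t (g⁻¹ • x)) (g⁻¹ • x)
  rw [this, hm (g⁻¹ * t x) (g⁻¹ • x) (by rw [rep_smul, mul_smul, ht]), add_sub_cancel_right]

/-- If `σ` and `τ` are induced by group endomorphisms, every `(σ, τ)`-derivation of the group
algebra over a domain in which the order of the group is nonzero is `(σ, τ)`-inner. -/
theorem IsSigmaTauDerivation.isSigmaTauInner_of_isLinearExtension {G R : Type*} [Group G]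
    [Finite G] [CommRing R] [IsDomain R] (hG : (Nat.card G : R) ≠ 0)
    {σ τ : MonoidAlgebra R G →ₐ[R] MonoidAlgebra R G}
    (hσ : IsLinearExtension σ) (hτ : IsLinearExtension τ)
    {δ : MonoidAlgebra R G →ₗ[R] MonoidAlgebra R G} (hδ : IsSigmaTauDerivation σ τ δ) :
    IsSigmaTauInner σ τ δ := by
  obtain ⟨f, hf⟩ := hσ
  obtain ⟨k, hk⟩ := hτ
  let act : MulAction G G :=
    { smul g x := f g * x * (k g)⁻¹
      one_smul x := by change f 1 * x * (k 1)⁻¹ = x; simp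
      mul_smul g h x := by
        change f (g * h) * x * (k (g * h))⁻¹ = f g * (f h * x * (k h)⁻¹) * (k g)⁻¹
        simp [mul_assoc] }
  obtain ⟨m, hm⟩ := @exists_coboundary_of_cocycle G G R _ _ act _ _ hG
    -- The shift by `k g` absorbs the right factor `τ h` of the Leibniz rule, leaving an untwisted
    -- first term.
    (fun g x => (δ (MonoidAlgebra.of R G g)).coeff (x * k g)) (fun g h x => by
      change _ = _ + (δ _).coeff (f g⁻¹ * x * (k g⁻¹)⁻¹ * k h)
      rw [map_mul (MonoidAlgebra.of R G), hδ, hf, hk, map_mul k]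
      simp [mul_assoc])
  have hm' (g x : G) : (δ (MonoidAlgebra.of R G g)).coeff (x * k g) = m x - m ((f g)⁻¹ * x * k g) := by
    refine (hm g x).trans ?_
    change m x - m (f g⁻¹ * x * (k g⁻¹)⁻¹) = _
    simp
  refine ⟨⟨Finsupp.equivFunOnFinite.symm m⟩, fun a => ?_⟩
  induction a using MonoidAlgebra.induction_on with
  | of g =>
    rw [hf, hk]
    ext x
    have := hm' g (x * (k g)⁻¹)
    simpa [mul_assoc] using this
  | add a b ha hb => rw [map_add, map_add, map_add, ha, hb, mul_add, add_mul]; abel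
  | smul r a ha => simp only [map_smul, ha, mul_smul_comm, smul_mul_assoc, smul_sub]

theorem mainTheorem1 {G R : Type*} [Group G] [Finite G] [CommRing R] [IsDomain R]
    (p : ℕ) [CharP R p] (hp : ¬ p ∣ Nat.card G) :
    (IsField R →
      ∀ σ τ : MonoidAlgebra R G →ₐ[R] MonoidAlgebra R G,
        FixesCenter σ → FixesCenter τ →
        ∀ δ : MonoidAlgebra R G →ₗ[R] MonoidAlgebra R G,
          IsSigmaTauDerivation σ τ δ → IsSigmaTauInner σ τ δ) ∧
    (¬ IsField R →
      ∀ σ τ : MonoidAlgebra R G →ₐ[R] MonoidAlgebra R G,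
        IsLinearExtension σ → IsLinearExtension τ →
        FixesCenter σ → FixesCenter τ →
        ∀ δ : MonoidAlgebra R G →ₗ[R] MonoidAlgebra R G,
          IsSigmaTauDerivation σ τ δ → IsSigmaTauInner σ τ δ) := by
  have hG : (Nat.card G : R) ≠ 0 := fun h => hp ((CharP.cast_eq_zero_iff R p _).mp h)
  refine ⟨fun hR σ τ _ _ δ hδ => ?_, fun _ σ τ hσ hτ _ _ δ hδ => ?_⟩
  · obtain ⟨b, hb⟩ := hR.mul_inv_cancel hG
    exact hδ.isSigmaTauInner_of_isUnit_card (IsUnit.of_mul_eq_one b hb)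
  · exact hδ.isSigmaTauInner_of_isLinearExtension hG hσ hτ
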